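/- Let $s \ge 2$ be an integer. For $\gamma \in \mathbb{R}$ define $Q_\gamma : \mathbb{R} \to \mathbb{R}$ by $$Q_\gamma(x) = \begin{cases} x+1, & x \le \gamma,\\ 1+s(1-x), & x > \gamma.\end{cases}$$ For $k \ge 1$ write $Q_\gamma^k(\gamma^\pm) = \lim_{x \to \gamma^\pm} Q_\gamma^k(x)$ and $(Q_\gamma^k)'(\gamma^\pm) = \lim_{x \to \gamma^\pm} (Q_\gamma^k)'(x)$. The matching set is the set of all $\gamma \in \mathbb{R}$ for which there are positive integers $\kappa^-, \kappa^+$ such that $$Q_\gamma^{\kappa^-}(\gamma^-) = Q_\gamma^{\kappa^+}(\gamma^+), \qquad (Q_\gamma^{\kappa^-})'(\gamma^-) = (Q_\gamma^{\kappa^+})'(\gamma^+),$$ and $\gamma$ does not belong to the prematching set $$\{Q_\gamma^j(\gamma^-) : 1 \le j \le \kappa^- - 1\} \cup \{Q_\gamma^j(\gamma^+) : 1 \le j \le \kappa^+ - 1\}.$$ The bifurcation set $\mathcal{E}$ is the complement in $\mathbb{R}$ of the matching set. Then $\mathcal{E} \subset \left[0, \frac{s}{s+1}\right]$, the set $\mathcal{E}$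 has zero Lebesgue measure, its Hausdorff dimension is $HD(\mathcal{E}) = 1$, and $HD(\mathcal{E} \setminus [0,\delta)) < 1$ for every $\delta > 0$. -/

import Mathlib

open Set Filter Topology MeasureTheory

namespace PiecewiseAffineMatching

/-- The piecewise affine map `Q_γ` of slope `s`: `x ↦ x + 1` for `x ≤ γ` and
`x ↦ 1 + s (1 - x)` for `x > γ`. -/
noncomputable def Q (s γ : ℝ) (x : ℝ) : ℝ :=
  if x ≤ γ then x + 1 else 1 + s * (1 - x)

/-- `p = Q_γ^k(γ⁻)`: the point `p` is the limit of `Q_γ^k(x)` as `x` increases to `γ`. -/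
def IsLowerOrbitPoint (s γ : ℝ) (k : ℕ) (p : ℝ) : Prop :=
  Tendsto (fun x => (Q s γ)^[k] x) (𝓝[<] γ) (𝓝 p)

/-- `p = Q_γ^k(γ⁺)`: the point `p` is the limit of `Q_γ^k(x)` as `x` decreases to `γ`. -/
def IsUpperOrbitPoint (s γ : ℝ) (k : ℕ) (p : ℝ) : Prop :=
  Tendsto (fun x => (Q s γ)^[k] x) (𝓝[>] γ) (𝓝 p)

/-- `d = (Q_γ^k)'(γ⁻)`: the map `Q_γ^k` is differentiable just to the left of `γ`, and its
derivative tends to `d` there. -/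
def IsLowerDeriv (s γ : ℝ) (k : ℕ) (d : ℝ) : Prop :=
  (∀ᶠ x in 𝓝[<] γ, DifferentiableAt ℝ ((Q s γ)^[k]) x) ∧
    Tendsto (fun x => deriv ((Q s γ)^[k]) x) (𝓝[<] γ) (𝓝 d)

/-- `d = (Q_γ^k)'(γ⁺)`: the map `Q_γ^k` is differentiable just to the right of `γ`, and its
derivative tends to `d` there. -/
def IsUpperDeriv (s γ : ℝ) (k : ℕ) (d : ℝ) : Prop :=
  (∀ᶠ x in 𝓝[>] γ, DifferentiableAt ℝ ((Q s γ)^[k]) x) ∧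
    Tendsto (fun x => deriv ((Q s γ)^[k]) x) (𝓝[>] γ) (𝓝 d)

/-- The matching condition with matching exponents `κm = κ⁻` and `κp = κ⁺`: both are positive,
`Q_γ^{κ⁻}(γ⁻) = Q_γ^{κ⁺}(γ⁺)` and `(Q_γ^{κ⁻})'(γ⁻) = (Q_γ^{κ⁺})'(γ⁺)`. -/
def MatchingCondition (s γ : ℝ) (κm κp : ℕ) : Prop :=
  0 < κm ∧ 0 < κp ∧
    (∃ p : ℝ, IsLowerOrbitPoint s γ κm p ∧ IsUpperOrbitPoint s γ κp p) ∧
    (∃ d : ℝ, IsLowerDeriv s γ κm d ∧ IsUpperDeriv s γ κp d)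

/-- The prematching set `PM_γ`: the points `Q_γ^j(γ⁻)` for `1 ≤ j ≤ κ⁻ - 1` together with the
points `Q_γ^j(γ⁺)` for `1 ≤ j ≤ κ⁺ - 1`. -/
def prematchingSet (s γ : ℝ) (κm κp : ℕ) : Set ℝ :=
  {p | (∃ j : ℕ, 1 ≤ j ∧ j < κm ∧ IsLowerOrbitPoint s γ j p) ∨
    (∃ j : ℕ, 1 ≤ j ∧ j < κp ∧ IsUpperOrbitPoint s γ j p)}

/-- The matching set: the parameters `γ` for which the matching condition holds with some
exponents for which `γ` is not in the prematching set. -/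
def matchingSet (s : ℝ) : Set ℝ :=
  {γ | ∃ κm κp : ℕ, MatchingCondition s γ κm κp ∧ γ ∉ prematchingSet s γ κm κp}

/-- The bifurcation set: the complement of the matching set. -/
def bifurcationSet (s : ℝ) : Set ℝ :=
  (matchingSet s)ᶜ

end PiecewiseAffineMatching

namespace PiecewiseAffineMatching

/-! ### Orbits of `Q` and their slopes -/

/-! The two one-sided orbits pass through `1 - s * γ` and `1 + s * (1 - γ)`, which differ by the
integer `s`. While they stay an integer apart, the lower point climbs by unit steps into the window
`(γ, γ + 1]`. If it reaches the upper point first, the orbits match. Otherwise both points expand: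
their order flips, the gap is multiplied by `s`, and the residue modulo 1 by `-s`. A residue below
`γ` forces a merger (`meet_of_fract_lt`); residues always above `γ` prevent one
(`not_meet_of_lt_fract`). Hence, for irrational `γ` in `[0, s / (s + 1)]` and up to equality cases,
`γ` is a bifurcation parameter iff `{(-s)^j γ} ≥ γ` for all `j ≥ 1`. Rational parameters are
countable, so they affect no dimension.

For `γ ≥ δ`, even powers of `-s` show that `γ` has no digit 0 in a base `b` that is a large power of
`s`, so the dimension is at most `log_b (b - 1) < 1`. Letting `δ` tend to 0 gives measure zero.

For full dimension, take numbers whose base `s^M` digits are neither first nor last. Their residues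
under all powers of `-s` stay away from 0, so small rescaled copies lie in the bifurcation set, and
their dimension tends to 1 as `M` grows. -/

theorem Q_of_le {s γ x : ℝ} (h : x ≤ γ) : Q s γ x = x + 1 := if_pos h

theorem Q_of_lt {s γ x : ℝ} (h : γ < x) : Q s γ x = 1 + s * (1 - x) := if_neg h.not_ge

/-- The slope of the branch of `Q` at `x`. -/
noncomputable def branchSlope (s γ x : ℝ) : ℝ := if x ≤ γ then 1 else -s

theorem branchSlope_of_le {s γ x : ℝ} (h : x ≤ γ) : branchSlope s γ x = 1 := if_pos h

theorem branchSlope_of_lt {s γ x : ℝ} (h : γ < x) : branchSlope s γ x = -s := if_neg h.not_ge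

/-- The slope of `Q^k` at `x`, as the product of the branch slopes along the orbit. -/
noncomputable def orbitSlope (s γ : ℝ) : ℕ → ℝ → ℝ
  | 0, _ => 1
  | k + 1, x => branchSlope s γ x * orbitSlope s γ k (Q s γ x)

theorem orbitSlope_zero (s γ x : ℝ) : orbitSlope s γ 0 x = 1 := rfl

theorem orbitSlope_succ (s γ : ℝ) (k : ℕ) (x : ℝ) :
    orbitSlope s γ (k + 1) x = branchSlope s γ x * orbitSlope s γ k (Q s γ x) := rfl

theorem eventually_Q_eq {s γ y : ℝ} (h : y ≠ γ) :
    ∀ᶠ x in 𝓝 y, Q s γ x = Q s γ y + branchSlope s γ y * (x - y) := by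
  rcases h.lt_or_gt with h | h
  · filter_upwards [Iio_mem_nhds h] with x hx
    rw [Q_of_le (le_of_lt hx), Q_of_le h.le, branchSlope_of_le h.le]; ring
  · filter_upwards [Ioi_mem_nhds h] with x hx
    rw [Q_of_lt hx, Q_of_lt h, branchSlope_of_lt h]; ring

theorem eventually_iterate_eq {s γ : ℝ} (k : ℕ) (y : ℝ)
    (h : ∀ j < k, (Q s γ)^[j] y ≠ γ) :
    ∀ᶠ x in 𝓝 y, (Q s γ)^[k] x = (Q s γ)^[k] y + orbitSlope s γ k y * (x - y) := by
  induction k generalizing y with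
  | zero => exact Eventually.of_forall fun x => by simp [orbitSlope]
  | succ k ih =>
    have h0 := eventually_Q_eq (s := s) (h 0 (Nat.succ_pos k))
    simp only [Function.iterate_zero, id] at h0
    have hc : Tendsto (Q s γ) (𝓝 y) (𝓝 (Q s γ y)) := by
      have : ContinuousAt (fun x => Q s γ y + branchSlope s γ y * (x - y)) y := by fun_prop
      refine Tendsto.congr' (f₁ := fun x => Q s γ y + branchSlope s γ y * (x - y)) ?_ ?_
      · filter_upwards [h0] with x hx using hx.symm
      · simpa [ContinuousAt] using this
    have := hc.eventually (ih (Q s γ y) fun j hj => by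
      simpa [Function.iterate_succ_apply] using h (j + 1) (by omega))
    filter_upwards [h0, this] with x hx hx'
    rw [Function.iterate_succ_apply, Function.iterate_succ_apply, hx', hx, orbitSlope]
    ring

theorem one_sided_of_eventually_affine {f : ℝ → ℝ} {U : Set ℝ} (hU : IsOpen U) {γ a d : ℝ}
    (h : ∀ᶠ x in 𝓝[U] γ, f x = a + d * (x - γ)) :
    Tendsto f (𝓝[U] γ) (𝓝 a) ∧ (∀ᶠ x in 𝓝[U] γ, DifferentiableAt ℝ f x) ∧
      Tendsto (fun x => deriv f x) (𝓝[U] γ) (𝓝 d) := by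
  have h' : ∀ᶠ x in 𝓝[U] γ, HasDerivAt f d x := by
    have h2 := eventually_eventually_nhdsWithin.2 h
    filter_upwards [h2, self_mem_nhdsWithin] with x hx hxU
    rw [hU.nhdsWithin_eq hxU] at hx
    have : HasDerivAt (fun x => a + d * (x - γ)) d x := by
      simpa using (((hasDerivAt_id x).sub_const γ).const_mul d).const_add a
    exact this.congr_of_eventuallyEq hx
  refine ⟨?_, h'.mono fun x hx => hx.differentiableAt, ?_⟩
  · refine Tendsto.congr' (f₁ := fun x => a + d * (x - γ)) (h.mono fun x hx => hx.symm) ?_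
    have : ContinuousAt (fun x => a + d * (x - γ)) γ := by fun_prop
    simpa [ContinuousAt] using this.tendsto.mono_left (nhdsWithin_le_nhds (s := U))
  · exact Tendsto.congr' (h'.mono fun x hx => hx.deriv.symm) tendsto_const_nhds

theorem lower_orbit {s γ : ℝ} {k : ℕ} (h : ∀ j < k, (Q s γ)^[j] (γ + 1) ≠ γ) :
    IsLowerOrbitPoint s γ (k + 1) ((Q s γ)^[k] (γ + 1)) ∧
      IsLowerDeriv s γ (k + 1) (orbitSlope s γ k (γ + 1)) := by
  have h1 := eventually_iterate_eq k (γ + 1) h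
  have hc : Tendsto (fun x : ℝ => x + 1) (𝓝[<] γ) (𝓝 (γ + 1)) :=
    ((continuous_id.add continuous_const).tendsto γ).mono_left nhdsWithin_le_nhds
  refine one_sided_of_eventually_affine (U := Iio γ) isOpen_Iio ?_
  filter_upwards [hc.eventually h1, self_mem_nhdsWithin] with x hx hxγ
  rw [Function.iterate_succ_apply, Q_of_le (le_of_lt hxγ), hx]
  ring

theorem upper_orbit {s γ : ℝ} {k : ℕ} (h : ∀ j < k, (Q s γ)^[j] (1 + s * (1 - γ)) ≠ γ) :
    IsUpperOrbitPoint s γ (k + 1) ((Q s γ)^[k] (1 + s * (1 - γ))) ∧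
      IsUpperDeriv s γ (k + 1) (-s * orbitSlope s γ k (1 + s * (1 - γ))) := by
  have h1 := eventually_iterate_eq k (1 + s * (1 - γ)) h
  have hc : Tendsto (fun x : ℝ => 1 + s * (1 - x)) (𝓝[>] γ) (𝓝 (1 + s * (1 - γ))) := by
    have : Continuous fun x : ℝ => 1 + s * (1 - x) := by fun_prop
    exact (this.tendsto γ).mono_left nhdsWithin_le_nhds
  refine one_sided_of_eventually_affine (U := Ioi γ) isOpen_Ioi ?_
  filter_upwards [hc.eventually h1, self_mem_nhdsWithin] with x hx hxγ
  rw [Function.iterate_succ_apply, Q_of_lt hxγ, hx]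
  ring

/-- Avoiding `γ` serves twice: it makes the iterates locally affine along both orbits, so one-sided
limits and derivatives are actual orbit values and slopes, and it keeps `γ` out of the prematching
set. The exponents are `k + 1` and `l + 1`, as the orbits start at the first one-sided images. -/
theorem mem_matchingSet_of_iterate_eq {s γ : ℝ} {k l : ℕ}
    (hk : ∀ j < k, (Q s γ)^[j] (γ + 1) ≠ γ) (hl : ∀ j < l, (Q s γ)^[j] (1 + s * (1 - γ)) ≠ γ)
    (heq : (Q s γ)^[k] (γ + 1) = (Q s γ)^[l] (1 + s * (1 - γ)))
    (hslope : orbitSlope s γ k (γ + 1) = -s * orbitSlope s γ l (1 + s * (1 - γ))) :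
    γ ∈ matchingSet s := by
  refine ⟨k + 1, l + 1, ⟨k.succ_pos, l.succ_pos, ⟨_, (lower_orbit hk).1, ?_⟩,
    ⟨_, (lower_orbit hk).2, ?_⟩⟩, ?_⟩
  · rw [heq]; exact (upper_orbit hl).1
  · rw [hslope]; exact (upper_orbit hl).2
  · rintro (⟨j, hj, hjk, hp⟩ | ⟨j, hj, hjk, hp⟩)
    · obtain ⟨i, rfl⟩ : ∃ i, j = i + 1 := ⟨j - 1, by omega⟩
      exact hk i (by omega)
        (tendsto_nhds_unique (lower_orbit fun q hq => hk q (by omega)).1 hp)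
    · obtain ⟨i, rfl⟩ : ∃ i, j = i + 1 := ⟨j - 1, by omega⟩
      exact hl i (by omega)
        (tendsto_nhds_unique (upper_orbit fun q hq => hl q (by omega)).1 hp)

theorem exists_iterate_eq_of_mem_matchingSet {s γ : ℝ}
    (hk : ∀ j, (Q s γ)^[j] (γ + 1) ≠ γ) (hl : ∀ j, (Q s γ)^[j] (1 + s * (1 - γ)) ≠ γ)
    (h : γ ∈ matchingSet s) :
    ∃ k l, (Q s γ)^[k] (γ + 1) = (Q s γ)^[l] (1 + s * (1 - γ)) ∧
      orbitSlope s γ k (γ + 1) = -s * orbitSlope s γ l (1 + s * (1 - γ)) := by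
  obtain ⟨κm, κp, ⟨h1, h2, ⟨p, hp, hp'⟩, ⟨d, hd, hd'⟩⟩, -⟩ := h
  obtain ⟨k, rfl⟩ : ∃ i, κm = i + 1 := ⟨κm - 1, by omega⟩
  obtain ⟨l, rfl⟩ : ∃ i, κp = i + 1 := ⟨κp - 1, by omega⟩
  have hL := lower_orbit (k := k) fun j _ => hk j
  have hU := upper_orbit (k := l) fun j _ => hl j
  refine ⟨k, l, ?_, ?_⟩
  · rw [tendsto_nhds_unique hL.1 hp, tendsto_nhds_unique hU.1 hp']
  · rw [tendsto_nhds_unique hL.2.2 hd.2, tendsto_nhds_unique hU.2.2 hd'.2]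

/-- The orbits of `x` and `y` meet, with the same slope. -/
def Meet (s γ x y : ℝ) : Prop :=
  ∃ k l, (Q s γ)^[k] x = (Q s γ)^[l] y ∧ orbitSlope s γ k x = orbitSlope s γ l y

theorem Meet.symm {s γ x y : ℝ} (h : Meet s γ x y) : Meet s γ y x := by
  obtain ⟨k, l, h1, h2⟩ := h
  exact ⟨l, k, h1.symm, h2.symm⟩

theorem Meet.of_expand {s γ x y : ℝ} (hx : γ < x) (hy : γ < y)
    (h : Meet s γ (1 + s * (1 - x)) (1 + s * (1 - y))) : Meet s γ x y := by
  obtain ⟨k, l, h1, h2⟩ := h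
  refine ⟨k + 1, l + 1, ?_, ?_⟩
  · rw [Function.iterate_succ_apply, Function.iterate_succ_apply, Q_of_lt hx, Q_of_lt hy, h1]
  · simp only [orbitSlope, Q_of_lt hx, Q_of_lt hy, branchSlope_of_lt hx, branchSlope_of_lt hy, h2]

theorem climb {s γ y : ℝ} (m : ℕ) (h : y + m ≤ γ + 1) :
    (Q s γ)^[m] y = y + m ∧ ∀ k, orbitSlope s γ (m + k) y = orbitSlope s γ k (y + m) := by
  induction m generalizing y with
  | zero => simp
  | succ m ih =>
    push_cast at h
    have hy : y ≤ γ := by have := m.cast_nonneg (α := ℝ); linarith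
    have := ih (y := y + 1) (by linarith)
    rw [Function.iterate_succ_apply, Q_of_le hy, this.1]
    refine ⟨by push_cast; ring, fun k => ?_⟩
    rw [show m + 1 + k = (m + k) + 1 by ring, orbitSlope, Q_of_le hy, branchSlope_of_le hy,
      this.2, one_mul]
    congr 1; push_cast; ring

theorem Meet.of_climb {s γ x y : ℝ} (m : ℕ) (h : y + m ≤ γ + 1) (hm : Meet s γ x (y + m)) :
    Meet s γ x y := by
  obtain ⟨k, l, h1, h2⟩ := hm
  refine ⟨k, m + l, ?_, ?_⟩
  · rw [add_comm m l, Function.iterate_add_apply, (climb m h).1, h1]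
  · rw [(climb m h).2, h2]

theorem Meet.refl (s γ x : ℝ) : Meet s γ x x := ⟨0, 0, rfl, rfl⟩

theorem exists_climb {γ y : ℝ} (h : y ≤ γ + 1) : ∃ t : ℕ, γ < y + t ∧ y + t ≤ γ + 1 := by
  refine ⟨⌊γ + 1 - y⌋₊, ?_, ?_⟩
  · have := Nat.lt_floor_add_one (γ + 1 - y); linarith
  · have := Nat.floor_le (a := γ + 1 - y) (by linarith); linarith

theorem expand_fract (s : ℕ) (j : ℕ) (x : ℝ) (m : ℤ) :
    Int.fract ((-(s : ℝ)) ^ j * (1 + s * (1 - x) - m)) = Int.fract ((-(s : ℝ)) ^ (j + 1) * x) := by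
  rw [Int.fract_eq_fract]
  refine ⟨(-(s : ℤ)) ^ j * (1 + s - m), ?_⟩
  push_cast; ring

/-- Induction on the number of expansions before the residue falls below `γ`. At that moment the
climbing point sits in `[1, γ + 1)`, so its image is at most `γ + 1` and the other image, now lower
by an integer, climbs onto it. -/
theorem meet_of_fract_lt {s : ℕ} {γ : ℝ} (h0 : 0 ≤ γ) (j : ℕ) :
    ∀ (W : ℝ) (m : ℕ), W ≤ γ + 1 → Int.fract ((-(s : ℝ)) ^ j * W) < γ →
      Meet s γ (W + m) W := by
  induction j with
  | zero =>
    intro W m hW hf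
    obtain ⟨t, ht, ht'⟩ := exists_climb hW
    rcases le_or_gt m t with hmt | hmt
    · have : (m : ℝ) ≤ t := by exact_mod_cast hmt
      exact Meet.of_climb m (by linarith) (Meet.refl _ _ _)
    obtain ⟨n, rfl⟩ := Nat.exists_eq_add_of_lt hmt
    have hn := n.cast_nonneg (α := ℝ)
    have hs := s.cast_nonneg (α := ℝ)
    have hW1 : 1 ≤ W + t := by
      by_contra! hlt
      have : Int.fract (W + t) = W + t := Int.fract_eq_self.2 ⟨by linarith, hlt⟩
      rw [Int.fract_add_natCast] at this
      simp only [pow_zero, one_mul] at hf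
      linarith
    refine Meet.of_climb t ht' (Meet.of_expand (by push_cast; linarith) ht (Meet.symm ?_))
    -- Expansion reverses the order, so the image of the former upper point is the new lower one,
    -- with gap `s * (n + 1)`.
    have e : 1 + (s : ℝ) * (1 - (W + t)) =
        1 + (s : ℝ) * (1 - (W + (t + n + 1 : ℕ))) + (s * (n + 1) : ℕ) := by push_cast; ring
    have hle : 1 + (s : ℝ) * (1 - (W + t)) ≤ γ + 1 := by nlinarith
    rw [e] at hle ⊢
    exact Meet.of_climb _ hle (Meet.refl _ _ _)
  | succ j ih =>
    intro W m hW hf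
    obtain ⟨t, ht, ht'⟩ := exists_climb hW
    rcases le_or_gt m t with hmt | hmt
    · have : (m : ℝ) ≤ t := by exact_mod_cast hmt
      exact Meet.of_climb m (by linarith) (Meet.refl _ _ _)
    obtain ⟨n, rfl⟩ := Nat.exists_eq_add_of_lt hmt
    have hn := n.cast_nonneg (α := ℝ)
    have hs := s.cast_nonneg (α := ℝ)
    refine Meet.of_climb t ht' (Meet.of_expand (by push_cast; linarith) ht (Meet.symm ?_))
    have e : 1 + (s : ℝ) * (1 - (W + t)) =
        1 + (s : ℝ) * (1 - (W + (t + n + 1 : ℕ))) + (s * (n + 1) : ℕ) := by push_cast; ring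
    rw [e]
    refine ih _ _ ?_ ?_
    · push_cast
      nlinarith
    · have := expand_fract s j W (s * (t + n + 1 : ℕ))
      rw [← this] at hf
      convert hf using 3
      push_cast; ring

theorem one_le_abs_orbitSlope {s γ : ℝ} (hs : 1 ≤ s) (k : ℕ) (x : ℝ) :
    1 ≤ |orbitSlope s γ k x| := by
  induction k generalizing x with
  | zero => simp [orbitSlope]
  | succ k ih =>
    rw [orbitSlope, abs_mul]
    refine one_le_mul_of_one_le_of_one_le ?_ (ih _)
    unfold branchSlope
    split_ifs
    · simp
    · simpa using hs.trans (le_abs_self s)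

/-- Excludes a match between an orbit that has expanded and one still of slope 1. -/
theorem neg_mul_orbitSlope_ne_one {s γ : ℝ} (hs : 2 ≤ s) (k : ℕ) (x : ℝ) :
    -s * orbitSlope s γ k x ≠ 1 := by
  intro h
  have := one_le_abs_orbitSlope (γ := γ) (by linarith : 1 ≤ s) k x
  have h' := congrArg abs h
  rw [abs_mul, abs_neg, abs_one, abs_of_pos (by linarith : 0 < s)] at h'
  nlinarith

/-- The invariant is that the upper point stays above `γ + 1` while the lower one does not. Climbing
preserves it, and after a joint expansion it holds with the roles exchanged. Equality of slopes
rules out one point expanding alone. -/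
theorem not_meet_of_lt_fract {s : ℕ} {γ : ℝ} (hs : 2 ≤ s) (h0 : 0 ≤ γ) (N : ℕ) :
    ∀ (k l : ℕ) (W : ℝ) (m : ℕ), k + l ≤ N → W ≤ γ + 1 → γ + 1 < W + m →
      (∀ j, γ < Int.fract ((-(s : ℝ)) ^ j * W)) →
      ¬ ((Q s γ)^[k] (W + m) = (Q s γ)^[l] W ∧
        orbitSlope s γ k (W + m) = orbitSlope s γ l W) := by
  have hs' : (2 : ℝ) ≤ s := by exact_mod_cast hs
  induction N with
  | zero =>
    rintro k l W m hkl hW hm - ⟨h, -⟩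
    obtain rfl : k = 0 := by omega
    obtain rfl : l = 0 := by omega
    simp only [Function.iterate_zero, id] at h
    linarith
  | succ N ih =>
    rintro k l W m hkl hW hm hf ⟨h, hsl⟩
    cases l with
    | zero =>
      cases k with
      | zero =>
        simp only [Function.iterate_zero, id] at h
        linarith
      | succ k =>
        rw [orbitSlope_zero, orbitSlope_succ, branchSlope_of_lt (by linarith)] at hsl
        exact neg_mul_orbitSlope_ne_one hs' _ _ hsl
    | succ l =>
      rcases le_or_gt W γ with hWγ | hWγ
      · obtain ⟨n, rfl⟩ : ∃ n, m = n + 1 := by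
          refine ⟨m - 1, ?_⟩
          have : m ≠ 0 := by rintro rfl; simp at hm; linarith
          omega
        push_cast at hm
        refine ih k l (W + 1) n (by omega) (by linarith) (by linarith) (fun j => ?_) ⟨?_, ?_⟩
        · have : Int.fract ((-(s : ℝ)) ^ j * (W + 1)) = Int.fract ((-(s : ℝ)) ^ j * W) := by
            rw [Int.fract_eq_fract]
            exact ⟨(-(s : ℤ)) ^ j, by push_cast; ring⟩
          rw [this]; exact hf j
        · rw [Function.iterate_succ_apply, Q_of_le hWγ] at h
          rw [← h]; push_cast; ring_nf
        · rw [orbitSlope_succ, Q_of_le hWγ, branchSlope_of_le hWγ, one_mul] at hsl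
          rw [← hsl]; push_cast; ring_nf
      · cases k with
        | zero =>
          rw [orbitSlope_zero, orbitSlope_succ, branchSlope_of_lt hWγ] at hsl
          exact neg_mul_orbitSlope_ne_one hs' _ _ hsl.symm
        | succ k =>
          have hV : γ < W + m := by linarith
          rw [Function.iterate_succ_apply, Function.iterate_succ_apply, Q_of_lt hWγ,
            Q_of_lt hV] at h
          rw [orbitSlope_succ, orbitSlope_succ, Q_of_lt hWγ, Q_of_lt hV, branchSlope_of_lt hWγ,
            branchSlope_of_lt hV, mul_right_inj' (by linarith)] at hsl
          have e : 1 + (s : ℝ) * (1 - W) = 1 + (s : ℝ) * (1 - (W + m)) + (s * m : ℕ) := by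
            push_cast; ring
          rw [e] at h hsl
          have hff : ∀ j, γ < Int.fract ((-(s : ℝ)) ^ j * (1 + (s : ℝ) * (1 - (W + m)))) := by
            intro j
            have := expand_fract s j W (s * m)
            have hj := hf (j + 1)
            rw [← this] at hj
            convert hj using 3
            push_cast; ring
          have hf0 := hf 0
          have hff0 := hff 0
          simp only [pow_zero, one_mul] at hf0 hff0
          -- In the window, a residue above `γ` leaves only the interval `(γ, 1)`.
          have hW1 : W < 1 := by
            by_contra! hge
            have : W - 1 < 1 := by have := Int.fract_lt_one W; linarith
            have := Int.fract_eq_self.2 ⟨sub_nonneg.2 hge, this⟩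
            rw [Int.fract_sub_one] at this
            linarith
          refine ih l k _ (s * m) (by omega) ?_ ?_ hff ⟨?_, ?_⟩
          · nlinarith
          · rw [← e]
            -- Otherwise this image would have residue `s * (1 - W) ≤ γ`.
            by_contra! hle
            have hγ1 := hf0.trans (Int.fract_lt_one W)
            have : Int.fract (1 + (s : ℝ) * (1 - (W + m))) = (s : ℝ) * (1 - W) := by
              rw [show 1 + (s : ℝ) * (1 - (W + m)) = s * (1 - W) + 1 - (s * m : ℕ) by
                push_cast; ring, Int.fract_sub_natCast, Int.fract_add_one, Int.fract_eq_self]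
              constructor <;> nlinarith
            linarith
          · exact h.symm
          · exact hsl.symm

/-! ### Parameters outside `[0, s / (s + 1)]` -/

theorem iterate_climb {s γ y : ℝ} {m j : ℕ} (h : y + m ≤ γ + 1) (hj : j ≤ m) :
    (Q s γ)^[j] y = y + j := by
  have : (j : ℝ) ≤ m := by exact_mod_cast hj
  exact (climb j (by linarith)).1

/-- The bound on `γ` says that `1 + s * (1 - γ) < γ + 1`, so `1 - s * γ` climbs `s` steps straight
onto it. -/
theorem mem_matchingSet_of_gt {s : ℕ} (hs : 2 ≤ s) {γ : ℝ} (h : (s : ℝ) / (s + 1) < γ) :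
    γ ∈ matchingSet s := by
  have hs' : (2 : ℝ) ≤ s := by exact_mod_cast hs
  rw [div_lt_iff₀ (by linarith)] at h
  have hQ : Q s γ (γ + 1) = 1 - s * γ := by rw [Q_of_lt (by linarith)]; ring
  have hc : (1 - s * γ : ℝ) + s ≤ γ + 1 := by linarith
  refine mem_matchingSet_of_iterate_eq (k := s + 1) (l := 0) ?_ (by simp) ?_ ?_
  · intro j hj
    cases j with
    | zero => simp
    | succ j =>
      have hj' : (j : ℝ) + 1 ≤ s := by exact_mod_cast (by omega : j + 1 ≤ s)
      rw [Function.iterate_succ_apply, hQ, iterate_climb hc (by omega)]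
      linarith
  · rw [Function.iterate_succ_apply, hQ, iterate_climb hc le_rfl]
    simp; ring
  · have := (climb (s := s) s hc).2 0
    rw [add_zero] at this
    rw [orbitSlope_succ, hQ, branchSlope_of_lt (by linarith), this]
    simp [orbitSlope]

/-- Each side expands twice, leaving a gap `s ^ 2` whose upper end `1 + s ^ 2 * γ` is below `γ + 1`;
the other orbit climbs it. -/
theorem mem_matchingSet_of_neg {s : ℕ} (hs : 2 ≤ s) {γ : ℝ} (h : γ < 0) :
    γ ∈ matchingSet s := by
  have hs' : (2 : ℝ) ≤ s := by exact_mod_cast hs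
  have hQ : Q s γ (γ + 1) = 1 - s * γ := by rw [Q_of_lt (by linarith)]; ring
  have h1 : γ < 1 - s * γ := by nlinarith
  have hQQ : Q s γ (1 - s * γ) = 1 + s ^ 2 * γ := by rw [Q_of_lt h1]; ring
  have h2 : γ < 1 + s * (1 - γ) := by nlinarith
  have hb : Q s γ (1 + s * (1 - γ)) = 1 + s ^ 2 * γ - s ^ 2 := by rw [Q_of_lt h2]; ring
  have hsq : (s : ℝ) ^ 2 * γ < γ := by
    have : 1 < (s : ℝ) ^ 2 := by nlinarith
    nlinarith
  have hc : (1 + s ^ 2 * γ - s ^ 2 : ℝ) + (s ^ 2 : ℕ) ≤ γ + 1 := by push_cast; linarith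
  refine mem_matchingSet_of_iterate_eq (k := 2) (l := s ^ 2 + 1) ?_ ?_ ?_ ?_
  · intro j hj
    interval_cases j
    · simp
    · simpa [hQ] using h1.ne'
  · intro j hj
    cases j with
    | zero => simpa using h2.ne'
    | succ j =>
      have hj' : (j : ℝ) + 1 ≤ (s : ℝ) ^ 2 := by exact_mod_cast (by omega : j + 1 ≤ s ^ 2)
      rw [Function.iterate_succ_apply, hb, iterate_climb hc (by omega)]
      linarith
  · rw [Function.iterate_succ_apply _ (s ^ 2), hb, iterate_climb hc le_rfl]
    simp [hQ, hQQ]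
  · simp only [orbitSlope]
    rw [hQ, hb, branchSlope_of_lt h1, branchSlope_of_lt h2, branchSlope_of_lt (by linarith),
      ← add_zero (s ^ 2), (climb _ hc).2]
    simp [orbitSlope]

theorem bifurcationSet_subset_Icc {s : ℕ} (hs : 2 ≤ s) :
    bifurcationSet s ⊆ Icc (0 : ℝ) ((s : ℝ) / (s + 1)) := by
  intro γ hγ
  constructor
  · by_contra! h
    exact hγ (mem_matchingSet_of_neg hs h)
  · by_contra! h
    exact hγ (mem_matchingSet_of_gt hs h)

/-! ### Irrational parameters -/

/-- Here `n` counts expansions. A return to `γ` would thus be an integer linear equation for `γ`,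
impossible for irrational `γ`. -/
theorem exists_iterate_eq (s : ℕ) (γ : ℝ) (j : ℕ) (y : ℝ) :
    ∃ (n : ℕ) (N : ℤ), (Q s γ)^[j] y = (-(s : ℝ)) ^ n * y + N ∧ (n = 0 → 0 ≤ N) := by
  induction j with
  | zero => exact ⟨0, 0, by simp⟩
  | succ j ih =>
    obtain ⟨n, N, h, hn⟩ := ih
    rw [Function.iterate_succ_apply']
    rcases le_or_gt ((Q s γ)^[j] y) γ with hle | hlt
    · refine ⟨n, N + 1, ?_, fun h0 => by have := hn h0; omega⟩
      rw [Q_of_le hle, h]; push_cast; ring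
    · refine ⟨n + 1, 1 + s - s * N, ?_, by simp⟩
      rw [Q_of_lt hlt, h]; push_cast; ring

theorem pow_succ_mul_ne_add_int {s : ℕ} (hs : 2 ≤ s) {γ : ℝ} (hγ : Irrational γ) (n : ℕ) (N : ℤ) :
    (-(s : ℝ)) ^ (n + 1) * γ + N ≠ γ := by
  intro h
  have hne : (-(s : ℤ)) ^ (n + 1) - 1 ≠ 0 := by
    intro h0
    have h1 : (-(s : ℤ)) ^ (n + 1) = 1 := by linarith
    have h2 := congrArg Int.natAbs h1
    rw [Int.natAbs_pow] at h2
    simp at h2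
    omega
  have := hγ.intCast_mul hne
  refine this.ne_int (-N) ?_
  push_cast
  linarith

theorem iterate_lower_ne {s : ℕ} (hs : 2 ≤ s) {γ : ℝ} (hγ : Irrational γ) (j : ℕ) :
    (Q s γ)^[j] (γ + 1) ≠ γ := by
  obtain ⟨n, N, h, hn⟩ := exists_iterate_eq s γ j (γ + 1)
  rw [h]
  cases n with
  | zero =>
    have : (0 : ℝ) ≤ N := by exact_mod_cast hn rfl
    simp only [pow_zero, one_mul]
    linarith
  | succ n =>
    convert pow_succ_mul_ne_add_int hs hγ n (N + (-(s : ℤ)) ^ (n + 1)) using 1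
    push_cast; ring

theorem iterate_upper_ne {s : ℕ} (hs : 2 ≤ s) {γ : ℝ} (hγ : Irrational γ) (j : ℕ) :
    (Q s γ)^[j] (1 + s * (1 - γ)) ≠ γ := by
  obtain ⟨n, N, h, -⟩ := exists_iterate_eq s γ j (1 + s * (1 - γ))
  rw [h]
  convert pow_succ_mul_ne_add_int hs hγ n (N + (-(s : ℤ)) ^ n * (1 + s)) using 1
  push_cast; ring

theorem Q_lower {s γ : ℝ} : Q s γ (γ + 1) = 1 - s * γ := by
  rw [Q_of_lt (by linarith)]; ring

theorem fract_lower (s : ℕ) (γ : ℝ) (j : ℕ) :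
    Int.fract ((-(s : ℝ)) ^ j * (1 - s * γ)) = Int.fract ((-(s : ℝ)) ^ (j + 1) * γ) := by
  rw [Int.fract_eq_fract]
  exact ⟨(-(s : ℤ)) ^ j, by push_cast; ring⟩

theorem le_fract_of_mem_bifurcationSet {s : ℕ} (hs : 2 ≤ s) {γ : ℝ} (hγ : Irrational γ)
    (hE : γ ∈ bifurcationSet s) (j : ℕ) : γ ≤ Int.fract ((-(s : ℝ)) ^ (j + 1) * γ) := by
  by_contra! hlt
  have hI := bifurcationSet_subset_Icc hs hE
  have h0 : 0 ≤ γ := hI.1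
  have hsγ : (0 : ℝ) ≤ s * γ := by positivity
  obtain ⟨k, l, he, hsl⟩ := meet_of_fract_lt (s := s) h0 j (1 - s * γ) s (by linarith)
    (by rwa [fract_lower])
  have e : (1 : ℝ) - s * γ + s = 1 + s * (1 - γ) := by ring
  rw [e] at he hsl
  refine hE (mem_matchingSet_of_iterate_eq (k := l + 1) (l := k)
    (fun j _ => iterate_lower_ne hs hγ j) (fun j _ => iterate_upper_ne hs hγ j) ?_ ?_)
  · rw [Function.iterate_succ_apply, Q_lower, he]
  · rw [orbitSlope_succ, Q_lower, branchSlope_of_lt (by linarith), hsl]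

theorem mem_bifurcationSet_of_lt_fract {s : ℕ} (hs : 2 ≤ s) {γ : ℝ} (hγ : Irrational γ)
    (h0 : 0 ≤ γ) (h : ∀ j, γ < Int.fract ((-(s : ℝ)) ^ (j + 1) * γ))
    (hle : γ ≤ (s : ℝ) / (s + 1)) : γ ∈ bifurcationSet s := by
  intro hM
  have hs' : (2 : ℝ) ≤ s := by exact_mod_cast hs
  obtain ⟨k, l, he, hsl⟩ := exists_iterate_eq_of_mem_matchingSet (iterate_lower_ne hs hγ)
    (iterate_upper_ne hs hγ) hM
  cases k with
  | zero =>
    rw [orbitSlope_zero] at hsl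
    exact neg_mul_orbitSlope_ne_one hs' _ _ hsl.symm
  | succ k =>
    have e : (1 : ℝ) + s * (1 - γ) = 1 - s * γ + s := by ring
    rw [Function.iterate_succ_apply, Q_lower, e] at he
    rw [orbitSlope_succ, Q_lower, branchSlope_of_lt (by linarith), e,
      mul_right_inj' (by linarith)] at hsl
    rw [le_div_iff₀ (by linarith)] at hle
    -- Equality would mean `γ = s / (s + 1)`, which is rational.
    have hne : γ + 1 ≠ 1 - s * γ + s := by
      intro h'
      have := pow_succ_mul_ne_add_int hs hγ 0 s
      apply this
      push_cast
      linarith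
    refine not_meet_of_lt_fract hs h0 _ l k (1 - s * γ) s le_rfl ?_ ?_ (fun j => ?_)
      ⟨he.symm, hsl.symm⟩
    · nlinarith
    · exact lt_of_le_of_ne (by linarith) hne
    · rw [fract_lower]; exact h j

/-! ### Hausdorff dimension of digit sets -/

open scoped NNReal ENNReal

/-- The bound makes `h` factor through `g` by a Hölder map of exponent `r`. -/
theorem dimH_range_le_of_dist_le_rpow {α : Type*} [Nonempty α] {g h : α → ℝ} {C r : ℝ≥0}
    (hr : 0 < r) (H : ∀ a b, dist (h a) (h b) ≤ C * dist (g a) (g b) ^ (r : ℝ)) :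
    dimH (range h) ≤ dimH (range g) / r := by
  have hf : ∀ a, h (Function.invFun g (g a)) = h a := fun a => by
    have hg : g (Function.invFun g (g a)) = g a := Function.invFun_eq ⟨a, rfl⟩
    have := H (Function.invFun g (g a)) a
    rw [hg, dist_self, Real.zero_rpow (by exact_mod_cast hr.ne'), mul_zero] at this
    exact dist_le_zero.1 this
  have himg : (h ∘ Function.invFun g) '' range g = range h := by
    rw [← range_comp]
    congr 1
    ext a
    exact hf a
  rw [← himg]
  refine HolderOnWith.dimH_image_le (C := C) (r := r) ?_ hr
  rintro _ ⟨a, rfl⟩ _ ⟨b, rfl⟩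
  simp only [Function.comp, hf, edist_dist]
  rw [ENNReal.ofReal_rpow_of_nonneg dist_nonneg r.coe_nonneg, ← ENNReal.ofReal_coe_nnreal,
    ← ENNReal.ofReal_mul C.coe_nonneg]
  exact ENNReal.ofReal_le_ofReal (H a b)

/-- The point with base `m + 2` digits `e i + 1`; neither `0` nor `m + 1` occurs as a digit. -/
noncomputable def middleDigits {m : ℕ} (e : ℕ → Fin m) : ℝ :=
  Real.ofDigits fun i => (e i).succ.castSucc

theorem ofDigits_eq_div {b : ℕ} (a : ℕ → Fin b) :
    Real.ofDigits a = (a 0 + Real.ofDigits fun i => a (i + 1)) / b := by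
  rw [Real.ofDigits_eq_sum_add_ofDigits a 1]
  simp [Real.ofDigitsTerm]
  ring

theorem middleDigits_eq_div {m : ℕ} (e : ℕ → Fin m) :
    middleDigits e = ((e 0 : ℝ) + 1 + middleDigits fun i => e (i + 1)) / (m + 2) := by
  rw [middleDigits, ofDigits_eq_div]
  simp only [Fin.val_castSucc, Fin.val_succ, middleDigits]
  push_cast
  ring

theorem middleDigits_mem {m : ℕ} (e : ℕ → Fin m) :
    middleDigits e ∈ Icc (1 / ((m : ℝ) + 2)) (1 - 1 / ((m : ℝ) + 2)) := by
  have h0 : 0 ≤ middleDigits fun i => e (i + 1) := Real.ofDigits_nonneg _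
  have h1 : (middleDigits fun i => e (i + 1)) ≤ 1 := Real.ofDigits_le_one _
  have h2 : (e 0 : ℝ) + 1 ≤ m := by exact_mod_cast (e 0).isLt
  have h3 : (0 : ℝ) ≤ (e 0 : ℕ) := Nat.cast_nonneg _
  rw [middleDigits_eq_div]
  constructor
  · gcongr
    linarith
  · rw [one_sub_div (by positivity)]
    gcongr
    linarith

theorem exists_pow_mul_middleDigits {m : ℕ} (e : ℕ → Fin m) (n : ℕ) :
    ∃ N : ℤ, ((m : ℝ) + 2) ^ n * middleDigits e = N + middleDigits fun i => e (i + n) := by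
  induction n generalizing e with
  | zero => exact ⟨0, by simp⟩
  | succ n ih =>
    obtain ⟨N, hN⟩ := ih fun i => e (i + 1)
    refine ⟨((m : ℤ) + 2) ^ n * (e 0 + 1) + N, ?_⟩
    rw [middleDigits_eq_div]
    have hm : ((m : ℝ) + 2) ≠ 0 := by positivity
    have : ((m : ℝ) + 2) ^ (n + 1) *
        (((e 0 : ℝ) + 1 + middleDigits fun i => e (i + 1)) / (m + 2)) =
        (m + 2) ^ n * (e 0 + 1) + (m + 2) ^ n * middleDigits fun i => e (i + 1) := by
      rw [pow_succ]; field_simp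
    rw [this, hN]
    push_cast
    simp only [add_assoc]

/-- Omitting the extreme digits keeps tails away from 0 and 1, so cylinders with different digits
are separated by a gap. -/
theorem le_abs_middleDigits_sub {m : ℕ} {e e' : ℕ → Fin m} {n : ℕ} (h : ∀ i < n, e i = e' i)
    (hn : e n ≠ e' n) :
    (((m : ℝ) + 2) ^ n)⁻¹ * (1 / ((m : ℝ) + 2) ^ 2) ≤ |middleDigits e - middleDigits e'| := by
  induction n generalizing e e' with
  | zero =>
    have hm : (0 : ℝ) < (m : ℝ) + 2 := by positivity
    rw [middleDigits_eq_div e, middleDigits_eq_div e', div_sub_div_same, abs_div, abs_of_pos hm,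
      pow_zero, inv_one, one_mul, sq, ← div_div]
    gcongr
    obtain ⟨h1, h2⟩ := middleDigits_mem fun i => e (i + 1)
    obtain ⟨h3, h4⟩ := middleDigits_mem fun i => e' (i + 1)
    have hp : 0 < 1 / ((m : ℝ) + 2) := by positivity
    rcases lt_or_gt_of_ne (fun hv => hn (Fin.ext hv) : (e 0 : ℕ) ≠ e' 0) with hlt | hlt
    · have : (e 0 : ℝ) + 1 ≤ (e' 0 : ℕ) := by exact_mod_cast hlt
      rw [abs_sub_comm]
      refine le_trans ?_ (le_abs_self _)
      linarith
    · have : (e' 0 : ℝ) + 1 ≤ (e 0 : ℕ) := by exact_mod_cast hlt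
      refine le_trans ?_ (le_abs_self _)
      linarith
  | succ n ih =>
    have := ih (e := fun i => e (i + 1)) (e' := fun i => e' (i + 1))
      (fun i hi => h (i + 1) (by omega)) hn
    have hm : (0 : ℝ) < (m : ℝ) + 2 := by positivity
    rw [middleDigits_eq_div e, middleDigits_eq_div e', h 0 n.succ_pos, div_sub_div_same, abs_div,
      abs_of_pos hm, add_sub_add_left_eq_sub, le_div_iff₀ hm]
    refine le_trans (le_of_eq ?_) this
    rw [pow_succ]
    field_simp

/-- Rereading the same digits in base `m` is `r`-Hölder and covers `[0, 1]`, which has dimension 1.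
-/
theorem le_dimH_range_middleDigits {m : ℕ} (hm : 2 ≤ m) {r : ℝ≥0} (hr : 0 < r)
    (hrm : ((m : ℝ) + 2) ^ (r : ℝ) ≤ m) :
    (r : ℝ≥0∞) ≤ dimH (range (middleDigits (m := m))) := by
  have : NeZero m := ⟨by omega⟩
  have hb : (0 : ℝ) < (m : ℝ) + 2 := by positivity
  have key : dimH (range (Real.ofDigits (b := m))) ≤ dimH (range (middleDigits (m := m))) / r := by
    refine dimH_range_le_of_dist_le_rpow (C := (((m : ℝ≥0) + 2) ^ 2) ^ (r : ℝ)) hr fun e e' => ?_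
    by_cases hee : e = e'
    · subst hee
      simp only [dist_self]
      positivity
    have hex : ∃ n, e n ≠ e' n := by
      by_contra! h
      exact hee (funext h)
    classical
    have hlt : ∀ i < Nat.find hex, e i = e' i := fun i hi => not_not.1 (Nat.find_min hex hi)
    set n := Nat.find hex
    have h1 := le_abs_middleDigits_sub hlt (Nat.find_spec hex)
    have h2 := Real.abs_ofDigits_sub_ofDigits_le hlt
    rw [Real.dist_eq, Real.dist_eq]
    push_cast
    rw [← Real.mul_rpow (by positivity) (abs_nonneg _)]
    calc |Real.ofDigits e - Real.ofDigits e'| ≤ ((m : ℝ) ^ n)⁻¹ := h2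
      _ ≤ ((((m : ℝ) + 2) ^ (r : ℝ)) ^ n)⁻¹ := by gcongr
      _ = ((((m : ℝ) + 2) ^ n)⁻¹) ^ (r : ℝ) := by
        rw [Real.inv_rpow (by positivity), ← Real.rpow_natCast, ← Real.rpow_natCast,
          ← Real.rpow_mul hb.le, ← Real.rpow_mul hb.le, mul_comm]
      _ ≤ _ := by
        gcongr
        have := mul_le_mul_of_nonneg_left h1 (by positivity : 0 ≤ ((m : ℝ) + 2) ^ 2)
        refine le_trans (le_of_eq ?_) this
        field_simp
  have h1 : (1 : ℝ≥0∞) ≤ dimH (range (Real.ofDigits (b := m))) := by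
    have hsub : Icc (0 : ℝ) 1 ⊆ range (Real.ofDigits (b := m)) := by
      rw [← image_univ]
      exact Real.ofDigits_SurjOn (by omega)
    refine le_trans (le_of_eq ?_) (dimH_mono hsub)
    have : (interior (Icc (0 : ℝ) 1)).Nonempty := by simp
    simpa using (Real.dimH_of_nonempty_interior this).symm
  have := h1.trans key
  rwa [ENNReal.le_div_iff_mul_le (Or.inl (by exact_mod_cast hr.ne')) (Or.inl ENNReal.coe_ne_top),
    one_mul] at this

/-- The numbers in `[0, 1)` whose orbit under multiplication by `b` modulo `1` avoids `[0, 1/b)`. -/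
def avoidingSet (b : ℕ) : Set ℝ :=
  {x | x ∈ Ico (0 : ℝ) 1 ∧ ∀ n : ℕ, 1 / (b : ℝ) ≤ Int.fract ((b : ℝ) ^ n * x)}

/-- The left endpoint of the base `b` cylinder whose digits are `w i + 1`. -/
noncomputable def cylinderLeft (b : ℕ) : (n : ℕ) → (Fin n → Fin (b - 1)) → ℝ
  | 0, _ => 0
  | n + 1, w => (cylinderLeft b n (fun i => w i.succ) + (w 0 + 1)) / b

theorem exists_mem_cylinder {b : ℕ} (hb : 2 ≤ b) (n : ℕ) {x : ℝ} (hx : x ∈ avoidingSet b) :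
    ∃ w : Fin n → Fin (b - 1),
      x ∈ Icc (cylinderLeft b n w) (cylinderLeft b n w + ((b : ℝ) ^ n)⁻¹) := by
  have hb0 : (0 : ℝ) < b := by positivity
  induction n generalizing x with
  | zero => exact ⟨fun i => i.elim0, by simpa [cylinderLeft] using Ico_subset_Icc_self hx.1⟩
  | succ n ih =>
    obtain ⟨⟨hx0, hx1⟩, hx⟩ := hx
    have hy : Int.fract (b * x) ∈ avoidingSet b := by
      refine ⟨⟨Int.fract_nonneg _, Int.fract_lt_one _⟩, fun k => ?_⟩
      have : Int.fract ((b : ℝ) ^ k * Int.fract (b * x)) = Int.fract ((b : ℝ) ^ (k + 1) * x) := by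
        rw [Int.fract_eq_fract, Int.fract]
        exact ⟨-(b : ℤ) ^ k * ⌊(b : ℝ) * x⌋, by push_cast; ring⟩
      rw [this]
      exact hx _
    obtain ⟨w, hw⟩ := ih hy
    have h1 : (1 : ℝ) ≤ b * x := by
      have := hx 0
      rwa [pow_zero, one_mul, Int.fract_eq_self.2 ⟨hx0, hx1⟩, div_le_iff₀ hb0, mul_comm] at this
    have hf1 : 1 ≤ ⌊(b : ℝ) * x⌋₊ := Nat.le_floor (by simpa using h1)
    have hf2 : ⌊(b : ℝ) * x⌋₊ < b := (Nat.floor_lt (by positivity)).2 (by nlinarith)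
    refine ⟨Fin.cons ⟨⌊(b : ℝ) * x⌋₊ - 1, by omega⟩ w, ?_⟩
    have hfl : ((⌊(b : ℝ) * x⌋₊ : ℕ) : ℝ) + Int.fract (b * x) = b * x := by
      rw [natCast_floor_eq_intCast_floor (by positivity)]
      exact Int.floor_add_fract _
    have hc : cylinderLeft b (n + 1) (Fin.cons ⟨⌊(b : ℝ) * x⌋₊ - 1, by omega⟩ w) =
        (cylinderLeft b n w + ⌊(b : ℝ) * x⌋₊) / b := by
      simp [cylinderLeft, Nat.cast_sub hf1]
    rw [hc]
    constructor
    · rw [div_le_iff₀ hb0]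
      linarith [hw.1]
    · rw [pow_succ, mul_inv, ← div_eq_mul_inv, ← add_div, le_div_iff₀ hb0]
      linarith [hw.2]

/-- At level `n`, `(b - 1) ^ n` cylinders of length `b ^ (-n)` cover the set; the exponent `d` makes
their `d`-th powers sum to exactly 1. -/
theorem dimH_avoidingSet_lt_one {b : ℕ} (hb : 2 ≤ b) : dimH (avoidingSet b) < 1 := by
  have hb' : (2 : ℝ) ≤ b := by exact_mod_cast hb
  set d : ℝ := Real.logb b (b - 1) with hd
  have hd0 : 0 ≤ d := Real.logb_nonneg (by linarith) (by linarith)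
  have hd1 : d < 1 := by
    rw [hd, Real.logb_lt_iff_lt_rpow (by linarith) (by linarith), Real.rpow_one]
    linarith
  have hbd : (b : ℝ) ^ d = b - 1 := Real.rpow_logb (by linarith) (by linarith) (by linarith)
  have hmeas : μH[d] (avoidingSet b) ≤ 1 := by
    have hdiam : ∀ (n : ℕ) (w : Fin n → Fin (b - 1)),
        Metric.ediam (Icc (cylinderLeft b n w) (cylinderLeft b n w + ((b : ℝ) ^ n)⁻¹)) =
          ENNReal.ofReal (((b : ℝ) ^ n)⁻¹) := fun n w => by
      rw [Real.ediam_Icc]; congr 1; ring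
    have hr : Tendsto (fun n : ℕ => ENNReal.ofReal (((b : ℝ) ^ n)⁻¹)) atTop (𝓝 0) := by
      rw [← ENNReal.ofReal_zero]
      refine ENNReal.tendsto_ofReal ?_
      exact tendsto_inv_atTop_zero.comp (tendsto_pow_atTop_atTop_of_one_lt (by linarith))
    refine (Measure.hausdorffMeasure_le_liminf_sum (ι := fun n => Fin n → Fin (b - 1)) d
      (avoidingSet b) (l := atTop) _ hr
      (fun n w => Icc (cylinderLeft b n w) (cylinderLeft b n w + ((b : ℝ) ^ n)⁻¹))
      (Eventually.of_forall fun n w => (hdiam n w).le)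
      (Eventually.of_forall fun n x hx => mem_iUnion.2 (exists_mem_cylinder hb n hx))).trans ?_
    refine le_of_eq ?_
    have : ∀ n : ℕ, ∑ w : Fin n → Fin (b - 1),
        Metric.ediam (Icc (cylinderLeft b n w) (cylinderLeft b n w + ((b : ℝ) ^ n)⁻¹)) ^ d = 1 := by
      intro n
      simp_rw [hdiam]
      have hp : (((b : ℝ) ^ n)⁻¹) ^ d = (((b : ℝ) - 1) ^ n)⁻¹ := by
        rw [Real.inv_rpow (by positivity), ← Real.rpow_natCast (b : ℝ) n,
          ← Real.rpow_mul (by linarith), mul_comm, Real.rpow_mul (by linarith), hbd,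
          Real.rpow_natCast]
      have hc : ((b - 1 : ℕ) : ℝ) = (b : ℝ) - 1 := by push_cast [Nat.cast_sub (by omega : 1 ≤ b)]; rfl
      rw [Finset.sum_const, Finset.card_univ, Fintype.card_fun, Fintype.card_fin, Fintype.card_fin,
        nsmul_eq_mul, ENNReal.ofReal_rpow_of_nonneg (by positivity) hd0, hp,
        ← ENNReal.ofReal_natCast, ← ENNReal.ofReal_mul (by positivity), Nat.cast_pow, hc,
        mul_inv_cancel₀ (pow_ne_zero _ (by linarith)), ENNReal.ofReal_one]
    rw [funext this, liminf_const]
  refine lt_of_le_of_lt (dimH_le_of_hausdorffMeasure_ne_top (d := ⟨d, hd0⟩) ?_) ?_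
  · exact ne_top_of_le_ne_top ENNReal.one_ne_top hmeas
  · exact ENNReal.coe_lt_one_iff.2 hd1

/-! ### Dimension of the bifurcation set -/

theorem dimH_bifurcationSet_diff_lt_one {s : ℕ} (hs : 2 ≤ s) {δ : ℝ} (hδ : 0 < δ) :
    dimH (bifurcationSet s \ Ico (0 : ℝ) δ) < 1 := by
  obtain ⟨M, hM⟩ := exists_pow_lt_of_lt_one hδ (by norm_num : (1 / 2 : ℝ) < 1)
  have hs' : (2 : ℝ) ≤ s := by exact_mod_cast hs
  have hb : 2 ≤ s ^ (2 * (M + 1)) := hs.trans (Nat.le_self_pow (by omega) s)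
  have hbδ : 1 / ((s ^ (2 * (M + 1)) : ℕ) : ℝ) ≤ δ := by
    refine le_trans ?_ hM.le
    rw [one_div_pow]
    push_cast
    refine one_div_le_one_div_of_le (by positivity) ?_
    calc (2 : ℝ) ^ M ≤ 2 ^ (2 * (M + 1)) := pow_le_pow_right₀ (by norm_num) (by omega)
      _ ≤ _ := by gcongr
  have hsub : bifurcationSet s \ Ico (0 : ℝ) δ ⊆
      avoidingSet (s ^ (2 * (M + 1))) ∪ range ((↑) : ℚ → ℝ) := by
    rintro γ ⟨hE, hγδ⟩
    by_cases hγ : Irrational γ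
    · left
      obtain ⟨h0, h1⟩ := bifurcationSet_subset_Icc hs hE
      have hlt : γ < 1 := h1.trans_lt <| (div_lt_one (by positivity)).2 (by linarith)
      have hge : δ ≤ γ := by
        by_contra! hlt
        exact hγδ ⟨h0, hlt⟩
      refine ⟨⟨h0, hlt⟩, fun n => hbδ.trans (hge.trans ?_)⟩
      cases n with
      | zero => rw [pow_zero, one_mul, Int.fract_eq_self.2 ⟨h0, hlt⟩]
      | succ n =>
        -- The exponent of `-s` becomes `2 * (M + 1) * (n + 1)`; being even, it removes the sign.
        have := le_fract_of_mem_bifurcationSet hs hγ hE (2 * (M + 1) * (n + 1) - 1)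
        rw [Nat.sub_add_cancel (Nat.mul_pos (by omega) (by omega)), mul_assoc, pow_mul,
          neg_sq, ← pow_mul, ← mul_assoc, pow_mul] at this
        rwa [Nat.cast_pow]
    · right
      rwa [Irrational, not_not] at hγ
  refine (dimH_mono hsub).trans_lt ?_
  rw [dimH_union, dimH_countable (countable_range _), max_lt_iff]
  exact ⟨dimH_avoidingSet_lt_one hb, one_pos⟩

theorem volume_bifurcationSet {s : ℕ} (hs : 2 ≤ s) : volume (bifurcationSet s) = 0 := by
  have hsub : bifurcationSet s ⊆
      {0} ∪ ⋃ n : ℕ, bifurcationSet s \ Ico (0 : ℝ) (1 / ((n : ℝ) + 1)) := by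
    intro γ hE
    rcases (bifurcationSet_subset_Icc hs hE).1.eq_or_lt with h | h
    · exact Or.inl h.symm
    · obtain ⟨n, hn⟩ := exists_nat_one_div_lt h
      exact Or.inr (mem_iUnion.2 ⟨n, hE, fun h' => h'.2.not_gt hn⟩)
  refine measure_mono_null hsub (measure_union_null (measure_singleton _)
    (measure_iUnion_null fun n => ?_))
  have := hausdorffMeasure_of_dimH_lt (d := 1)
    (by
      rw [ENNReal.coe_one]
      exact dimH_bifurcationSet_diff_lt_one hs (Nat.one_div_pos_of_nat (n := n)))
  rwa [NNReal.coe_one, hausdorffMeasure_real] at this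

/-- If the residue were smaller, at most `M` further factors of `s` would reach a whole digit shift
with a tail within `1 / (m + 2)` of an integer. Excluding both extreme digits handles either sign.
-/
theorem le_fract_pow_mul_middleDigits {s M m : ℕ} (hs : 2 ≤ s) (hm : m + 2 = s ^ M)
    (e : ℕ → Fin m) (j : ℕ) :
    1 / ((m : ℝ) + 2) ^ 2 ≤ Int.fract ((-(s : ℝ)) ^ j * middleDigits e) := by
  by_contra! hlt
  have hs' : (2 : ℝ) ≤ s := by exact_mod_cast hs
  have hm' : (m : ℝ) + 2 = (s : ℝ) ^ M := by exact_mod_cast hm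
  have hM : 0 < M := Nat.pos_of_ne_zero (by rintro rfl; simp at hm)
  obtain ⟨i, hi, n, hn⟩ : ∃ i ≤ M, ∃ n, i + j = M * n := by
    refine ⟨M * (j / M + 1) - j, ?_, j / M + 1, ?_⟩ <;>
    · have h1 := Nat.div_add_mod j M
      have h2 := Nat.mod_lt j hM
      rw [mul_add, mul_one]
      omega
  set f := Int.fract ((-(s : ℝ)) ^ j * middleDigits e) with hf
  have hf0 : 0 ≤ f := Int.fract_nonneg _
  have hb : (0 : ℝ) < (m : ℝ) + 2 := by positivity
  have hsi : (s : ℝ) ^ i * f < 1 / ((m : ℝ) + 2) := by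
    have h1 : (s : ℝ) ^ i ≤ (m : ℝ) + 2 := by
      rw [hm']; exact pow_le_pow_right₀ (by linarith) hi
    calc (s : ℝ) ^ i * f ≤ ((m : ℝ) + 2) * f := by gcongr
      _ < ((m : ℝ) + 2) * (1 / ((m : ℝ) + 2) ^ 2) := by gcongr
      _ = _ := by field_simp
  have hsi0 : 0 ≤ (s : ℝ) ^ i * f := by positivity
  obtain ⟨N, hN⟩ := exists_pow_mul_middleDigits e n
  obtain ⟨h1, h2⟩ := middleDigits_mem fun i => e (i + n)
  set z := middleDigits fun i => e (i + n)
  have hsign : ∀ k : ℕ, ∃ u : ℤ, (u = 1 ∨ u = -1) ∧ (-(s : ℝ)) ^ k = u * (s : ℝ) ^ k := by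
    intro k
    refine ⟨(-1) ^ k, neg_one_pow_eq_or ℤ k, ?_⟩
    push_cast
    rw [← mul_pow, neg_one_mul]
  obtain ⟨u, hu, hu'⟩ := hsign i
  obtain ⟨v, hv, hv'⟩ := hsign (i + j)
  have hmain : (v : ℝ) * (N + z) =
      u * ((s : ℝ) ^ i * ⌊(-(s : ℝ)) ^ j * middleDigits e⌋) + u * ((s : ℝ) ^ i * f) := by
    rw [← hN, hm', ← pow_mul, ← hn, ← mul_assoc, ← hv', pow_add, hu', hf, Int.fract]
    ring
  have hp : 0 < 1 / ((m : ℝ) + 2) := by positivity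
  have hint : ∃ A : ℤ, z = A + (s : ℝ) ^ i * f ∨ z = A - (s : ℝ) ^ i * f := by
    set q := ⌊(-(s : ℝ)) ^ j * middleDigits e⌋
    rcases hu with rfl | rfl <;> rcases hv with rfl | rfl <;> push_cast at hmain
    · exact ⟨s ^ i * q - N, Or.inl (by push_cast; linarith)⟩
    · exact ⟨-(s ^ i * q) - N, Or.inr (by push_cast; linarith)⟩
    · exact ⟨-(s ^ i * q) - N, Or.inr (by push_cast; linarith)⟩
    · exact ⟨s ^ i * q - N, Or.inl (by push_cast; linarith)⟩
  obtain ⟨A, hA | hA⟩ := hint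
  · have a1 : (0 : ℝ) < A := by linarith
    have a2 : (A : ℝ) < 1 := by linarith
    have a1' : (0 : ℤ) < A := by exact_mod_cast a1
    have a2' : A < (1 : ℤ) := by exact_mod_cast a2
    omega
  · have a1 : (0 : ℝ) < A := by linarith
    have a2 : (A : ℝ) < 1 := by linarith
    have a1' : (0 : ℤ) < A := by exact_mod_cast a1
    have a2' : A < (1 : ℤ) := by exact_mod_cast a2
    omega

/-- Scaling by an even power of `s` makes `γ` smaller than every residue of the digit number. For
lower exponents, `(-s) ^ (j + 1) * γ` has absolute value below `1 / 2`, and its residue is computed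
directly. -/
theorem middleDigits_div_mem_bifurcationSet {s M m : ℕ} (hs : 2 ≤ s) (hm : m + 2 = s ^ M)
    (e : ℕ → Fin m) (he : Irrational (middleDigits e)) :
    middleDigits e / (s : ℝ) ^ (2 * (M + 1)) ∈ bifurcationSet s := by
  have hs' : (2 : ℝ) ≤ s := by exact_mod_cast hs
  have hm' : (m : ℝ) + 2 = (s : ℝ) ^ M := by exact_mod_cast hm
  obtain ⟨h1, h2⟩ := middleDigits_mem e
  have hp : 0 < 1 / ((m : ℝ) + 2) := by positivity
  have hL : (0 : ℝ) < (s : ℝ) ^ (2 * (M + 1)) := by positivity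
  set γ := middleDigits e / (s : ℝ) ^ (2 * (M + 1)) with hγ
  have hx : middleDigits e = (s : ℝ) ^ (2 * (M + 1)) * γ := by rw [hγ]; field_simp
  have hγ0 : 0 < γ := div_pos (by linarith) hL
  have hmul : ∀ k, k ≤ 2 * (M + 1) → (s : ℝ) ^ k * γ < 1 := fun k hk => by
    have : (s : ℝ) ^ k * γ ≤ (s : ℝ) ^ (2 * (M + 1)) * γ := by
      gcongr
      linarith
    linarith
  have hγ2 : 2 * γ < 1 := by
    have := hmul 1 (by omega)
    rw [pow_one] at this
    nlinarith
  refine mem_bifurcationSet_of_lt_fract hs ?_ hγ0.le (fun j => ?_) ?_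
  · have := he.div_natCast (m := s ^ (2 * (M + 1))) (by positivity)
    rwa [Nat.cast_pow] at this
  · rcases le_or_gt (2 * (M + 1)) (j + 1) with hj | hj
    · obtain ⟨i, hi⟩ := Nat.exists_eq_add_of_le' hj
      have : (-(s : ℝ)) ^ (j + 1) * γ = (-(s : ℝ)) ^ i * middleDigits e := by
        rw [hi, pow_add, pow_mul (-(s : ℝ)), neg_sq, ← pow_mul, hx, mul_assoc]
      rw [this]
      refine lt_of_lt_of_le ?_ (le_fract_pow_mul_middleDigits hs hm e i)
      rw [hm', ← pow_mul, mul_comm M 2, lt_div_iff₀ (by positivity), mul_comm]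
      exact hmul _ (by omega)
    · have hz1 : s * ((s : ℝ) ^ (j + 1) * γ) < 1 := by
        rw [← mul_assoc, ← pow_succ']
        exact hmul _ (by omega)
      have hz0 : 2 * γ ≤ (s : ℝ) ^ (j + 1) * γ := by
        gcongr
        exact hs'.trans (le_self_pow₀ (by linarith) (by omega))
      have hz2 : 2 * ((s : ℝ) ^ (j + 1) * γ) < 1 := by nlinarith
      rcases Nat.even_or_odd (j + 1) with hpar | hpar
      · rw [hpar.neg_pow, Int.fract_eq_self.2 ⟨by linarith, by linarith⟩]
        linarith
      · have : Int.fract ((-(s : ℝ)) ^ (j + 1) * γ) = 1 - (s : ℝ) ^ (j + 1) * γ := by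
          rw [hpar.neg_pow, Int.fract_eq_iff]
          exact ⟨by linarith, by linarith, -1, by push_cast; ring⟩
        rw [this]
        linarith
  · rw [le_div_iff₀ (by linarith)]
    nlinarith

theorem dimH_range_middleDigits_le {s M m : ℕ} (hs : 2 ≤ s) (hm : m + 2 = s ^ M) :
    dimH (range (middleDigits (m := m))) ≤ dimH (bifurcationSet s) := by
  have hs' : (2 : ℝ) ≤ s := by exact_mod_cast hs
  have hsub : range (middleDigits (m := m)) ⊆
      (fun x : ℝ => (s : ℝ) ^ (2 * (M + 1)) * x) '' bifurcationSet s ∪ range ((↑) : ℚ → ℝ) := by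
    rintro _ ⟨e, rfl⟩
    by_cases he : Irrational (middleDigits e)
    · refine Or.inl ⟨_, middleDigits_div_mem_bifurcationSet hs hm e he, ?_⟩
      field_simp
    · right
      rwa [Irrational, not_not] at he
  refine (dimH_mono hsub).trans ?_
  rw [dimH_union, dimH_countable (countable_range _), max_eq_left zero_le]
  exact (lipschitzWith_smul ((s : ℝ) ^ (2 * (M + 1)))).dimH_image_le _

theorem dimH_bifurcationSet {s : ℕ} (hs : 2 ≤ s) : dimH (bifurcationSet (s : ℝ)) = 1 := by
  refine le_antisymm ((dimH_mono (subset_univ _)).trans_eq Real.dimH_univ) ?_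
  refine le_of_forall_lt fun c hc => ?_
  lift c to ℝ≥0 using hc.ne_top
  have hc1 : (c : ℝ) < 1 := by exact_mod_cast hc
  obtain ⟨n, hn⟩ := exists_nat_one_div_lt (sub_pos.2 hc1)
  have hs' : (2 : ℝ) ≤ s := by exact_mod_cast hs
  set M := n + 3 with hM
  obtain ⟨m, hm⟩ : ∃ m, s ^ M = m + 2 :=
    Nat.exists_eq_add_of_le' (hs.trans (Nat.le_self_pow (by omega) s))
  have h4 : 4 ≤ s ^ (n + 2) := by
    calc 4 = 2 ^ 2 := by norm_num
      _ ≤ s ^ 2 := Nat.pow_le_pow_left hs 2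
      _ ≤ s ^ (n + 2) := Nat.pow_le_pow_right (by omega) (by omega)
  have hms : s ^ (n + 2) ≤ m := by
    have : 2 * s ^ (n + 2) ≤ s ^ M := by
      rw [hM, pow_succ s (n + 2), mul_comm]
      exact Nat.mul_le_mul_left _ hs
    omega
  -- With `m + 2 = s ^ (n + 3)` and `m ≥ s ^ (n + 2)`, this exponent satisfies `(m + 2) ^ r ≤ m`,
  -- and `1 - r = 1 / (n + 3) < 1 - c`.
  set r : ℝ≥0 := ((n : ℝ≥0) + 2) / ((n : ℝ≥0) + 3) with hr
  have hrr : (r : ℝ) = ((n : ℝ) + 2) / (n + 3) := by rw [hr]; push_cast; ring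
  have hcr : (c : ℝ) < r := by
    rw [hrr, lt_div_iff₀ (by positivity)]
    rw [div_lt_iff₀ (by positivity)] at hn
    nlinarith
  have hrm : ((m : ℝ) + 2) ^ (r : ℝ) ≤ m := by
    have e1 : (m : ℝ) + 2 = (s : ℝ) ^ (n + 3) := by exact_mod_cast hm.symm
    have e2 : ((n + 3 : ℕ) : ℝ) * r = ((n + 2 : ℕ) : ℝ) := by
      rw [hrr]; push_cast; field_simp
    rw [e1, ← Real.rpow_natCast, ← Real.rpow_mul (by positivity), e2, Real.rpow_natCast]
    exact_mod_cast hms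
  calc (c : ℝ≥0∞) < r := by exact_mod_cast hcr
    _ ≤ _ := le_dimH_range_middleDigits (by omega) (by positivity) hrm
    _ ≤ _ := dimH_range_middleDigits_le hs hm.symm

end PiecewiseAffineMatching

theorem theorem1p10 (s : ℕ) (hs : 2 ≤ s) :
    PiecewiseAffineMatching.bifurcationSet (s : ℝ) ⊆ Set.Icc (0 : ℝ) ((s : ℝ) / ((s : ℝ) + 1)) ∧
    MeasureTheory.volume (PiecewiseAffineMatching.bifurcationSet (s : ℝ)) = 0 ∧
    dimH (PiecewiseAffineMatching.bifurcationSet (s : ℝ)) = 1 ∧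
    ∀ δ : ℝ, 0 < δ →
      dimH (PiecewiseAffineMatching.bifurcationSet (s : ℝ) \ Set.Ico (0 : ℝ) δ) < 1 :=
  ⟨PiecewiseAffineMatching.bifurcationSet_subset_Icc hs,
    PiecewiseAffineMatching.volume_bifurcationSet hs,
    PiecewiseAffineMatching.dimH_bifurcationSet hs,
    fun _ hδ => PiecewiseAffineMatching.dimH_bifurcationSet_diff_lt_one hs hδ⟩
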